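/- A *Banach Lie algebra* is a complex Lie algebra $\mathcal{L}$ that is a Banach space in some norm for which there is a constant $t>0$ with $\|[a,b]\|\le t\,\|a\|\,\|b\|$ for all $a,b\in\mathcal{L}$. Put $\mathcal{L}_{[0]}=\mathcal{L}^{[1]}=\mathcal{L}$, $\mathcal{L}_{[n+1]}=\overline{[\mathcal{L}_{[n]},\mathcal{L}_{[n]}]}$ and $\mathcal{L}^{[n+1]}=\overline{[\mathcal{L},\mathcal{L}^{[n]}]}$, where $[A,B]$ denotes the linear span of all $[a,b]$ with $a\in A$, $b\in B$. $\mathcal{L}$ is *solvable* if $\mathcal{L}_{[n]}=\{0\}$ for some $n$, and *nilpotent* if $\mathcal{L}^{[n]}=\{0\}$ for some $n$. $\mathcal{L}$ is *Frattini-free* (respectively *Jacobson-free*) if the intersection of all maximal proper closed Lie subalgebras (respectively Lie ideals) of finite codimension in $\mathcal{L}$ is $\{0\}$, where the intersection of the empty family is $\mathcal{L}$. **Theorem 9.10.** Let $\mathcal{L}$ be a Banach Lie algebra. (i) If $\mathcal{L}$ is Frattini-free and solvable, then $\mathcal{L}_{[2]}=\{0\}$. (ii) If $\mathcal{L}$ is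 Frattini-free, then $\mathcal{L}$ is nilpotent if and only if it is commutative. (iii) If $\mathcal{L}$ is Jacobson-free and solvable, then $\mathcal{L}$ is commutative. -/

import Mathlib

/-- A Banach Lie algebra: a complex Lie algebra that is a Banach space in some norm for which
the Lie bracket is bounded, `‖[a, b]‖ ≤ t ‖a‖ ‖b‖` for some multiplication constant `t > 0`.
The norm and the Lie structure share one addition and one scalar multiplication. -/
class BanachLieAlgebra (L : Type*) extends
    NormedAddCommGroup L, LieRing L, NormedSpace ℂ L, LieAlgebra ℂ L, CompleteSpace L where
  exists_multiplication_constant : ∃ t : ℝ, 0 < t ∧ ∀ a b : L, ‖⁅a, b⁆‖ ≤ t * ‖a‖ * ‖b‖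

namespace BanachLieAlgebra

/-- The bracket with a fixed left entry is continuous. -/
theorem continuous_lie_left {L : Type*} [BanachLieAlgebra L] (a : L) :
    Continuous fun x : L => ⁅a, x⁆ := by
  obtain ⟨t, -, ht⟩ := exists_multiplication_constant (L := L)
  exact AddMonoidHomClass.continuous_of_bound (LieModule.toEnd ℂ L L a) (t * ‖a‖)
    fun x => by simpa using ht a x

/-- The closure of a Lie ideal, again a Lie ideal. -/
def closure {L : Type*} [BanachLieAlgebra L] (I : LieIdeal ℂ L) : LieIdeal ℂ L :=
  { I.toSubmodule.topologicalClosure with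
    lie_mem := fun {a _} hx =>
      map_mem_closure (continuous_lie_left a) hx fun _ hy => lie_mem_right ℂ L I a _ hy }

/-- The closed derived series `L_[0] = L`, `L_[n+1] = closure [L_[n], L_[n]]`. Here `⁅I, J⁆` is
the linear span of the brackets of elements of the ideals `I` and `J`. -/
def derivedSeries (L : Type*) [BanachLieAlgebra L] : ℕ → LieIdeal ℂ L
  | 0 => ⊤
  | n + 1 => closure ⁅derivedSeries L n, derivedSeries L n⁆

/-- The closed lower central series. The index starts at zero: the `n`-th term is `L^[n+1]`,
where `L^[1] = L` and `L^[n+1] = closure [L, L^[n]]`. -/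
def lowerCentralSeries (L : Type*) [BanachLieAlgebra L] : ℕ → LieIdeal ℂ L
  | 0 => ⊤
  | n + 1 => closure ⁅(⊤ : LieIdeal ℂ L), lowerCentralSeries L n⁆

/-- `L` is solvable if some term of its closed derived series is zero. -/
def IsSolvable (L : Type*) [BanachLieAlgebra L] : Prop :=
  ∃ n : ℕ, derivedSeries L n = ⊥

/-- `L` is nilpotent if some term of its closed lower central series is zero. -/
def IsNilpotent (L : Type*) [BanachLieAlgebra L] : Prop :=
  ∃ n : ℕ, lowerCentralSeries L n = ⊥

/-- The maximal proper closed Lie subalgebras of finite codimension. -/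
def maximalSubalgebras (L : Type*) [BanachLieAlgebra L] : Set (LieSubalgebra ℂ L) :=
  {M | Maximal (fun K : LieSubalgebra ℂ L => K ≠ ⊤ ∧ IsClosed (K : Set L)) M ∧
    FiniteDimensional ℂ (L ⧸ M.toSubmodule)}

/-- The maximal proper closed Lie ideals of finite codimension. -/
def maximalIdeals (L : Type*) [BanachLieAlgebra L] : Set (LieIdeal ℂ L) :=
  {J | Maximal (fun K : LieIdeal ℂ L => K ≠ ⊤ ∧ IsClosed (K : Set L)) J ∧
    FiniteDimensional ℂ (L ⧸ J.toSubmodule)}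

/-- `L` is Frattini-free if the intersection of its maximal proper closed Lie subalgebras of
finite codimension is zero; the intersection of the empty family is `L`. -/
def IsFrattiniFree (L : Type*) [BanachLieAlgebra L] : Prop :=
  sInf (maximalSubalgebras L) = ⊥

/-- `L` is Jacobson-free if the intersection of its maximal proper closed Lie ideals of
finite codimension is zero; the intersection of the empty family is `L`. -/
def IsJacobsonFree (L : Type*) [BanachLieAlgebra L] : Prop :=
  sInf (maximalIdeals L) = ⊥

end BanachLieAlgebra

/-! Since the intersection of the maximal objects is zero, it suffices that each of them contains
the relevant brackets. Let `M` be a maximal subalgebra and `a ∉ M` an eigenvector of `M` modulo `M`.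
Then `M + ℂa` is a closed subalgebra, hence all of `L`, and any `x`, `y` with `⁅x, a⁆, ⁅y, a⁆ ∈ M`
satisfy `⁅x, y⁆ ∈ M` (`lie_mem_of_lie_eigenvector_mem`). In the nilpotent case `a` comes from the
last term of the series not inside `M`, with eigenvalue 0. In the solvable case Lie's theorem
supplies `a`, and the eigenvalue vanishes on brackets. For a maximal ideal `J`, the solvable
quotient `L ⧸ J` cannot be perfect. -/

namespace BanachLieAlgebra

section

variable {L : Type*} [BanachLieAlgebra L]

theorem le_closure (I : LieIdeal ℂ L) : I ≤ closure I :=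
  fun _ hx => Submodule.le_topologicalClosure I.toSubmodule hx

theorem mem_of_mem_closure {I : LieIdeal ℂ L} {S : Submodule ℂ L} (h : I.toSubmodule ≤ S)
    (hS : IsClosed (S : Set L)) {x : L} (hx : x ∈ closure I) : x ∈ S :=
  Submodule.topologicalClosure_minimal I.toSubmodule h hS hx

@[simp]
theorem closure_bot : closure (⊥ : LieIdeal ℂ L) = ⊥ := by
  refine le_bot_iff.1 fun x hx => ?_
  simpa using mem_of_mem_closure (S := ⊥) (by simp) (by simp) hx

theorem continuous_lie_right (a : L) : Continuous fun x : L => ⁅x, a⁆ := by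
  refine (continuous_lie_left a).neg.congr fun x => ?_
  exact lie_skew x a

theorem lie_mem_derivedSeries_succ {n : ℕ} {x y : L} (hx : x ∈ derivedSeries L n)
    (hy : y ∈ derivedSeries L n) : ⁅x, y⁆ ∈ derivedSeries L (n + 1) :=
  le_closure _ (LieSubmodule.lie_mem_lie hx hy)

theorem lie_mem_lowerCentralSeries_succ {n : ℕ} (x : L) {y : L}
    (hy : y ∈ lowerCentralSeries L n) : ⁅x, y⁆ ∈ lowerCentralSeries L (n + 1) :=
  le_closure _ (LieSubmodule.lie_mem_lie (LieSubmodule.mem_top x) hy)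

/-- The algebraic derived series is contained in the closed one. -/
theorem lieAlgebra_derivedSeries_le (n : ℕ) :
    LieAlgebra.derivedSeries ℂ L n ≤ derivedSeries L n := by
  induction n with
  | zero => exact le_top
  | succ n ih =>
    rw [LieAlgebra.derivedSeries_def, LieAlgebra.derivedSeriesOfIdeal_succ]
    exact (LieSubmodule.mono_lie ih ih).trans (le_closure _)

theorem IsSolvable.lieAlgebra_isSolvable (h : IsSolvable L) : LieAlgebra.IsSolvable L := by
  obtain ⟨n, hn⟩ := h
  exact LieAlgebra.IsSolvable.mk (R := ℂ) (k := n)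
    (le_bot_iff.1 (hn ▸ lieAlgebra_derivedSeries_le n))

theorem exists_last_not_le {D : ℕ → LieIdeal ℂ L} (h0 : D 0 = ⊤) {n : ℕ} (hn : D n = ⊥)
    {S : Submodule ℂ L} (hS : S ≠ ⊤) :
    ∃ k, ¬ (D k).toSubmodule ≤ S ∧ (D (k + 1)).toSubmodule ≤ S := by
  by_contra! h
  have key : ∀ k, ¬ (D k).toSubmodule ≤ S := by
    intro k
    induction k with
    | zero => simpa [h0] using hS
    | succ k ih => exact h k ih
  exact key n (by simp [hn])

theorem toSubmodule_ne_top_of_mem_maximalSubalgebras {M : LieSubalgebra ℂ L}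
    (hM : M ∈ maximalSubalgebras L) : M.toSubmodule ≠ ⊤ := by
  simpa using hM.1.prop.1

/-- A maximal closed subalgebra of finite codimension together with an eigenvector modulo it
spans the whole algebra. -/
theorem exists_eq_add_smul {M : LieSubalgebra ℂ L} (hM : M ∈ maximalSubalgebras L) {a : L}
    (ha : a ∉ M) (h : ∀ m ∈ M, ∃ c : ℂ, ⁅m, a⁆ - c • a ∈ M) (x : L) :
    ∃ m ∈ M, ∃ c : ℂ, m + c • a = x := by
  have hmem : ∀ x, x ∈ M.toSubmodule ⊔ ℂ ∙ a ↔ ∃ m ∈ M, ∃ c : ℂ, m + c • a = x := by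
    intro x
    simp [Submodule.mem_sup, Submodule.mem_span_singleton]
  let K : LieSubalgebra ℂ L :=
    { M.toSubmodule ⊔ ℂ ∙ a with
      lie_mem' := by
        intro x y hx hy
        obtain ⟨m, hm, c, rfl⟩ := (hmem x).1 hx
        obtain ⟨m', hm', c', rfl⟩ := (hmem y).1 hy
        obtain ⟨d, hd⟩ := h m hm
        obtain ⟨d', hd'⟩ := h m' hm'
        refine (hmem _).2 ⟨⁅m, m'⁆ + c' • (⁅m, a⁆ - d • a) - c • (⁅m', a⁆ - d' • a),
          sub_mem (add_mem (M.lie_mem hm hm') (M.smul_mem c' hd)) (M.smul_mem c hd'),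
          c' * d - c * d', ?_⟩
        rw [add_lie, lie_add, lie_add, smul_lie, smul_lie, lie_smul, lie_smul, lie_self,
          ← lie_skew a m']
        module }
  have hMK : M ≤ K := fun m hm => Submodule.mem_sup_left hm
  have : FiniteDimensional ℂ (L ⧸ M.toSubmodule) := hM.2
  have hK : IsClosed (K : Set L) :=
    Submodule.isClosed_mono_of_finiteDimensional_quotient
      (s := M.toSubmodule) (t := K.toSubmodule) hM.1.prop.2 hMK
  have haK : a ∈ K := Submodule.mem_sup_right (Submodule.mem_span_singleton_self a)
  have htop : K = ⊤ := by
    by_contra hne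
    exact ha (hM.1.le_of_ge ⟨hne, hK⟩ hMK haK)
  exact (hmem x).1 (show x ∈ K by simp [htop])

/-- Write `x = m + c • a` and `y = m' + c' • a`. As `⁅a, a⁆ = 0`, both `⁅m, a⁆` and `⁅m', a⁆` lie in
`M`, so every term of the expanded bracket does. -/
theorem lie_mem_of_lie_eigenvector_mem {M : LieSubalgebra ℂ L} (hM : M ∈ maximalSubalgebras L)
    {a : L} (ha : a ∉ M) (h : ∀ m ∈ M, ∃ c : ℂ, ⁅m, a⁆ - c • a ∈ M) {x y : L}
    (hx : ⁅x, a⁆ ∈ M) (hy : ⁅y, a⁆ ∈ M) : ⁅x, y⁆ ∈ M := by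
  obtain ⟨m, hm, c, rfl⟩ := exists_eq_add_smul hM ha h x
  obtain ⟨m', hm', c', rfl⟩ := exists_eq_add_smul hM ha h y
  simp only [add_lie, smul_lie, lie_self, smul_zero, add_zero] at hx hy
  rw [add_lie, lie_add, lie_add, smul_lie, smul_lie, lie_smul, lie_smul, lie_self, smul_zero,
    smul_zero, add_zero, ← lie_skew a m', smul_neg]
  exact add_mem (add_mem (M.lie_mem hm hm') (M.smul_mem c' hx)) (neg_mem (M.smul_mem c hy))

/-- In a nilpotent algebra, maximal closed subalgebras of finite codimension contain all
brackets. -/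
theorem IsNilpotent.lie_mem (h : IsNilpotent L) {M : LieSubalgebra ℂ L}
    (hM : M ∈ maximalSubalgebras L) (x y : L) : ⁅x, y⁆ ∈ M := by
  obtain ⟨n, hn⟩ := h
  obtain ⟨k, hk, hk'⟩ := exists_last_not_le (D := lowerCentralSeries L) rfl hn
    (toSubmodule_ne_top_of_mem_maximalSubalgebras hM)
  obtain ⟨a, ha, haM⟩ := Set.not_subset.1 hk
  have key : ∀ x : L, ⁅x, a⁆ ∈ M := fun x => hk' (lie_mem_lowerCentralSeries_succ x ha)
  exact lie_mem_of_lie_eigenvector_mem hM haM (fun m _ => ⟨0, by simpa using key m⟩)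
    (key x) (key y)

/-- In a solvable algebra, every maximal closed subalgebra of finite codimension admits a common
eigenvector outside it, modulo it, whose eigenvalue vanishes on brackets. -/
theorem IsSolvable.exists_eigenvector (h : IsSolvable L) {M : LieSubalgebra ℂ L}
    (hM : M ∈ maximalSubalgebras L) :
    ∃ a ∉ M, ∃ χ : L →ₗ[ℂ] ℂ, (∀ x, ⁅x, a⁆ - χ x • a ∈ M) ∧
      ∀ x y : L, χ ⁅x, y⁆ = 0 := by
  have := h.lieAlgebra_isSolvable
  obtain ⟨n, hn⟩ := h
  obtain ⟨k, hk, hk'⟩ := exists_last_not_le (D := derivedSeries L) rfl hn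
    (toSubmodule_ne_top_of_mem_maximalSubalgebras hM)
  set A : LieIdeal ℂ L := derivedSeries L k
  have hAA : ∀ x ∈ A, ∀ y ∈ A, ⁅x, y⁆ ∈ M :=
    fun x hx y hy => hk' (lie_mem_derivedSeries_succ hx hy)
  obtain ⟨b, hb, hbM⟩ := Set.not_subset.1 hk
  -- `M + A` is a subalgebra because `A` is an ideal, and `b` makes it larger than `M`.
  have hMA : ∀ x : L, ∃ m ∈ M, ∃ a ∈ A, m + a = x := by
    let K : LieSubalgebra ℂ L :=
      { M.toSubmodule ⊔ A.toSubmodule with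
        lie_mem' := by
          intro x y hx hy
          obtain ⟨m, hm, a, ha, rfl⟩ := Submodule.mem_sup.1 hx
          obtain ⟨m', hm', a', ha', rfl⟩ := Submodule.mem_sup.1 hy
          refine Submodule.mem_sup.2 ⟨⁅m, m'⁆, M.lie_mem hm hm', ⁅m, a'⁆ + ⁅a, m' + a'⁆,
            add_mem (lie_mem_right ℂ L A _ _ ha') (lie_mem_left ℂ L A _ _ ha), ?_⟩
          rw [add_lie m a, lie_add m, add_assoc] }
    have hMK : M ≤ K := fun m hm => Submodule.mem_sup_left hm
    have : FiniteDimensional ℂ (L ⧸ M.toSubmodule) := hM.2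
    have hK : IsClosed (K : Set L) :=
      Submodule.isClosed_mono_of_finiteDimensional_quotient
        (s := M.toSubmodule) (t := K.toSubmodule) hM.1.prop.2 hMK
    have htop : K = ⊤ := by
      by_contra hne
      exact hbM (hM.1.le_of_ge ⟨hne, hK⟩ hMK (Submodule.mem_sup_right hb))
    exact fun x => Submodule.mem_sup.1 (show x ∈ K by simp [htop])
  -- `A ∩ M` is stable under `M`, and under `A` because `⁅A, A⁆ ⊆ M`; hence under `L = M + A`.
  let W : LieSubmodule ℂ L A :=
    { M.toSubmodule.comap A.toSubmodule.subtype with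
      lie_mem := by
        intro x w hw
        change ⁅x, (w : L)⁆ ∈ M
        obtain ⟨m, hm, a, ha, rfl⟩ := hMA x
        rw [add_lie]
        exact add_mem (M.lie_mem hm hw) (hAA a ha w w.2) }
  have hW : ∀ w : A, w ∈ W ↔ (w : L) ∈ M := fun w => Iff.rfl
  have : FiniteDimensional ℂ (L ⧸ M.toSubmodule) := hM.2
  have : FiniteDimensional ℂ (A ⧸ W) := by
    let f : A →ₗ[ℂ] L ⧸ M.toSubmodule := M.toSubmodule.mkQ ∘ₗ A.toSubmodule.subtype
    have hf : W.toSubmodule = LinearMap.ker f := by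
      ext w
      simp only [LinearMap.mem_ker, f, LinearMap.comp_apply, Submodule.mkQ_apply,
        Submodule.Quotient.mk_eq_zero]
      rfl
    exact Module.Finite.of_injective (W.toSubmodule.liftQ f hf.le)
      (LinearMap.ker_eq_bot.1 (Submodule.ker_liftQ_eq_bot _ _ _ hf.ge))
  have : Nontrivial (A ⧸ W) := by
    refine nontrivial_of_ne (LieSubmodule.Quotient.mk' W ⟨b, hb⟩) 0 fun h0 => hbM ?_
    exact (hW _).1 ((LieSubmodule.Quotient.mk_eq_zero W).1 h0)
  -- Lie's theorem, for the finite-dimensional module `A ⧸ W`.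
  obtain ⟨χ, hχ⟩ := LieModule.exists_nontrivial_weightSpace_of_isSolvable ℂ L (A ⧸ W)
  obtain ⟨⟨v, hv⟩, hv0⟩ := exists_ne (0 : LieModule.weightSpace (A ⧸ W) χ)
  rw [LieModule.mem_weightSpace] at hv
  have hχχ : ∀ x y : L, χ ⁅x, y⁆ = 0 := by
    intro x y
    have hxy : χ ⁅x, y⁆ • v = 0 := by
      rw [← hv, lie_lie, hv, hv, lie_smul, lie_smul, hv, hv, smul_comm, sub_self]
    exact (smul_eq_zero.1 hxy).resolve_right fun h0 => hv0 (Subtype.ext h0)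
  obtain ⟨a, rfl⟩ := LieSubmodule.Quotient.surjective_mk' W v
  refine ⟨a, fun haM => hv0 ?_, χ, fun x => ?_, hχχ⟩
  · ext
    exact (LieSubmodule.Quotient.mk_eq_zero W).2 ((hW a).2 haM)
  · have hx := hv x
    rw [← LieModuleHom.map_lie, ← map_smul, ← sub_eq_zero,
      ← map_sub] at hx
    exact (hW _).1 ((LieSubmodule.Quotient.mk_eq_zero W).1 hx)

/-- In a solvable algebra, maximal closed subalgebras of finite codimension contain all brackets
of elements of the first closed derived algebra. -/
theorem IsSolvable.lie_mem (h : IsSolvable L) {M : LieSubalgebra ℂ L}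
    (hM : M ∈ maximalSubalgebras L) {x y : L} (hx : x ∈ derivedSeries L 1)
    (hy : y ∈ derivedSeries L 1) : ⁅x, y⁆ ∈ M := by
  obtain ⟨a, ha, χ, hχ, hχχ⟩ := h.exists_eigenvector hM
  -- `S` consists of the `x` with `⁅x, a⁆ ∈ M`; being closed, it contains the closure of the span of
  -- brackets once it contains the brackets.
  let S : Submodule ℂ L := M.toSubmodule.comap ((LieModule.toEnd ℂ L L : L →ₗ[ℂ] Module.End ℂ L).flip a)
  have hS : IsClosed (S : Set L) := hM.1.prop.2.preimage (continuous_lie_right a)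
  have hle : (⁅derivedSeries L 0, derivedSeries L 0⁆ : LieIdeal ℂ L).toSubmodule ≤ S := by
    rw [LieSubmodule.lieIdeal_oper_eq_linear_span', Submodule.span_le]
    rintro _ ⟨x, -, y, -, rfl⟩
    change ⁅⁅x, y⁆, a⁆ ∈ M
    simpa [hχχ] using hχ ⁅x, y⁆
  exact lie_mem_of_lie_eigenvector_mem hM ha (fun m _ => ⟨χ m, hχ m⟩)
    (mem_of_mem_closure hle hS hx) (mem_of_mem_closure hle hS hy)

/-- In a solvable algebra, maximal closed ideals of finite codimension contain all brackets. -/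
theorem IsSolvable.lie_mem_of_mem_maximalIdeals (h : IsSolvable L) {J : LieIdeal ℂ L}
    (hJ : J ∈ maximalIdeals L) (x y : L) : ⁅x, y⁆ ∈ J := by
  obtain ⟨n, hn⟩ := h.lieAlgebra_isSolvable.solvable ℂ L
  let K : LieIdeal ℂ L := J ⊔ ⁅(⊤ : LieIdeal ℂ L), (⊤ : LieIdeal ℂ L)⁆
  have : FiniteDimensional ℂ (L ⧸ J.toSubmodule) := hJ.2
  have hK : IsClosed (K : Set L) :=
    Submodule.isClosed_mono_of_finiteDimensional_quotient
      (s := J.toSubmodule) (t := K.toSubmodule) hJ.1.prop.2 (le_sup_left (a := J))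
  have hxy : ⁅x, y⁆ ∈ K := LieSubmodule.mem_sup_right
    (LieSubmodule.lie_mem_lie (LieSubmodule.mem_top x) (LieSubmodule.mem_top y))
  refine hJ.1.le_of_ge ⟨fun htop => hJ.1.prop.1 ?_, hK⟩ le_sup_left hxy
  -- If `J + ⁅L, L⁆ = L`, the quotient by `J` is perfect, so every derived term still maps onto it,
  -- even the zero one.
  have key : ∀ k, J ⊔ LieAlgebra.derivedSeries ℂ L k = ⊤ := by
    intro k
    induction k with
    | zero => simp
    | succ k ih =>
      rw [LieAlgebra.derivedSeries_def, LieAlgebra.derivedSeriesOfIdeal_succ,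
        ← LieAlgebra.derivedSeries_def]
      refine top_le_iff.1 (htop.ge.trans (sup_le le_sup_left ?_))
      rw [← ih, LieSubmodule.lie_sup, LieSubmodule.sup_lie, LieSubmodule.sup_lie]
      refine sup_le (sup_le ?_ ?_) (sup_le ?_ le_sup_right)
      · exact LieSubmodule.lie_le_right _ _ |>.trans le_sup_left
      · exact LieSubmodule.lie_le_right _ _ |>.trans le_sup_left
      · exact LieSubmodule.lie_le_left _ _ |>.trans le_sup_left
  simpa [hn] using key n

theorem IsFrattiniFree.eq_zero (h : IsFrattiniFree L) {x : L}
    (hx : ∀ M ∈ maximalSubalgebras L, x ∈ M) : x = 0 := by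
  have : x ∈ sInf (maximalSubalgebras L) := by
    simpa [← SetLike.mem_coe, LieSubalgebra.coe_sInf] using hx
  rwa [h, LieSubalgebra.mem_bot] at this

theorem IsJacobsonFree.eq_zero (h : IsJacobsonFree L) {x : L}
    (hx : ∀ J ∈ maximalIdeals L, x ∈ J) : x = 0 := by
  have : x ∈ sInf (maximalIdeals L) := by
    simpa [← SetLike.mem_coe, LieSubmodule.coe_sInf] using hx
  rwa [h, LieSubmodule.mem_bot] at this

theorem isNilpotent_of_isLieAbelian (h : IsLieAbelian L) : IsNilpotent L := by
  refine ⟨1, ?_⟩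
  have : ⁅(⊤ : LieIdeal ℂ L), (⊤ : LieIdeal ℂ L)⁆ = ⊥ :=
    le_bot_iff.1 ((LieSubmodule.lie_le_iff _ _ _).2 fun x _ y _ => by simp [trivial_lie_zero])
  simp [lowerCentralSeries, this]

end

end BanachLieAlgebra

theorem theorem9p10 (L : Type*) [BanachLieAlgebra L] :
    (BanachLieAlgebra.IsFrattiniFree L → BanachLieAlgebra.IsSolvable L →
      BanachLieAlgebra.derivedSeries L 2 = ⊥) ∧
    (BanachLieAlgebra.IsFrattiniFree L →
      (BanachLieAlgebra.IsNilpotent L ↔ IsLieAbelian L)) ∧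
    (BanachLieAlgebra.IsJacobsonFree L → BanachLieAlgebra.IsSolvable L → IsLieAbelian L) := by
  refine ⟨fun hF hS => ?_, fun hF => ⟨fun hN => ⟨fun x y => hF.eq_zero fun M hM =>
    hN.lie_mem hM x y⟩, BanachLieAlgebra.isNilpotent_of_isLieAbelian⟩,
    fun hJ hS => ⟨fun x y => hJ.eq_zero fun J hJ' => hS.lie_mem_of_mem_maximalIdeals hJ' x y⟩⟩
  have : ⁅BanachLieAlgebra.derivedSeries L 1, BanachLieAlgebra.derivedSeries L 1⁆ = ⊥ :=
    le_bot_iff.1 ((LieSubmodule.lie_le_iff _ _ _).2 fun x hx y hy =>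
      (LieSubmodule.mem_bot _).2 (hF.eq_zero fun M hM => hS.lie_mem hM hx hy))
  rw [BanachLieAlgebra.derivedSeries, this, BanachLieAlgebra.closure_bot]
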